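/- Let $n\ge 3$ be an integer and let $F$ be an infinite field of characteristic $\neq 2$. For a field $K$, let $T_n(K)$ denote the group of all invertible upper triangular $n\times n$ matrices over $K$, and let $PT_n(K)=T_n(K)/Z(T_n(K))$ be its quotient by its center. Write $\equiv$ for elementary equivalence, that is, satisfaction of the same first-order sentences (in the language of groups for groups, and in the language of rings for fields). If $H$ is a group with $H\equiv T_n(F)$, then $$H/Z(H)\cong PT_n(L)$$ for some field $L\equiv F$. -/

import Mathlib

universe u v

namespace TriangularGroups

/-- Function symbols of the first-order language of groups: product, inverse and identity. -/
inductive GroupFunc : ℕ → Type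
  | mul : GroupFunc 2
  | inv : GroupFunc 1
  | one : GroupFunc 0

/-- The first-order language of groups, with symbols `(*, ⁻¹, 1)` (and logical equality). -/
def groupLanguage : FirstOrder.Language.{0, 0} where
  Functions := GroupFunc
  Relations := fun _ => Empty

/-- A group as a structure for the language of groups, with the symbols read in the usual way. -/
@[reducible]
def groupStructure (G : Type u) [Group G] : groupLanguage.Structure G where
  funMap := fun {n} f =>
    match n, f with
    | _, GroupFunc.mul => fun x => x 0 * x 1
    | _, GroupFunc.inv => fun x => (x 0)⁻¹
    | _, GroupFunc.one => fun _ => 1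
  RelMap := fun {_} r => r.elim

/-- `G ≡ H` as groups: the same first-order sentences of the language of groups hold
in `G` and in `H`. -/
def GroupElemEquiv (G : Type u) (H : Type v) [Group G] [Group H] : Prop :=
  letI := groupStructure G
  letI := groupStructure H
  groupLanguage.ElementarilyEquivalent G H

/-- `K ≡ L` as fields: the same first-order sentences of the language of rings hold
in `K` and in `L`. -/
def FieldElemEquiv (K : Type u) (L : Type v) [Field K] [Field L] : Prop :=
  letI := FirstOrder.Ring.compatibleRingOfRing K
  letI := FirstOrder.Ring.compatibleRingOfRing L
  FirstOrder.Language.ring.ElementarilyEquivalent K L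

/-- The group `T_n(F)` of invertible upper triangular `n × n` matrices over the field `F`
(over a field, the diagonal entries of such a matrix are automatically units). -/
def T (n : ℕ) (F : Type u) [Field F] : Subgroup (Matrix.GeneralLinearGroup (Fin n) F) where
  carrier := {g | ∀ i j : Fin n, j < i → (g : Matrix (Fin n) (Fin n) F) i j = 0}
  one_mem' := by
    intro i j hij
    simp [hij.ne']
  mul_mem' := by
    intro a b ha hb
    exact Matrix.BlockTriangular.mul (b := id) (fun i j h => ha i j h) (fun i j h => hb i j h)
  inv_mem' := by
    intro a ha
    have h := Matrix.blockTriangular_inv_of_blockTriangular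
      (M := (a : Matrix (Fin n) (Fin n) F)) (b := id) (fun i j h => ha i j h)
    intro i j hij
    rw [Matrix.coe_units_inv]
    exact h hij

/-- `PT_n(F)`, the quotient of `T_n(F)` by its center. -/
abbrev PT (n : ℕ) (F : Type u) [Field F] : Type u :=
  T n F ⧸ Subgroup.center (T n F)

end TriangularGroups

/-! In T_n(F) the elements commuting with all commutators are exactly the matrices s + t·e with s ≠
0 and e the matrix unit of the top right corner. Conjugation by g multiplies t by the character
chi(g) = g_11/g_nn. The quotient (g a g⁻¹)(h a h⁻¹)⁻¹ therefore shifts the corner by a multiple of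
chi(g) − chi(h), and since F is infinite every element of F is such a difference. So F, with its
operations, is interpreted in the group without parameters: pairs (g, h) are codes, addition is
pointwise multiplication of the actions, and multiplication is composition (`fieldCoord_isRing`). In
a group H ≡ T_n(F) the same formulas define a field L ≡ F on `ActSet H` (`exists_field_actSet`).

To recover the matrices, choose suitable elementary x_i in row 1 and y_j in the last column. The
commutator of x_i with g y_j g⁻¹ lies in the corner and equals a known nonzero multiple of g_ij/g_nn
(`commutator_param`). Thus the entries of g up to a common scalar are definable from finitely many
parameters. That some parameters make this relation a multiplicative correspondence with triangular
matrices, matching the centers, is one first-order statement (`IsMatrixParam`). It passes to H and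
L, where it yields H/Z(H) ≅ PT_n(L). The common scalar is invisible, which is why only the quotients
by the centers are compared. -/

open FirstOrder Language

universe w w'

namespace TriangularGroups

attribute [local instance] groupStructure

/-! ### Predicates and functions defined by one formula in two groups -/

section CoDefinability

variable {G : Type u} {H : Type v} [Group G] [Group H] {α β ι κ : Type}

/-- A predicate on tuples of `G` and a predicate on tuples of `H` that are defined by one and
the same formula of the language of groups. -/
def CoDef (P : (α → G) → Prop) (Q : (α → H) → Prop) : Prop :=
  ∃ φ : groupLanguage.Formula α, (∀ v, P v ↔ φ.Realize v) ∧ ∀ v, Q v ↔ φ.Realize v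

theorem CoDef.not {P : (α → G) → Prop} {Q : (α → H) → Prop} (h : CoDef P Q) :
    CoDef (fun v => ¬ P v) (fun v => ¬ Q v) := by
  obtain ⟨φ, h1, h2⟩ := h
  exact ⟨φ.not, fun v => (not_congr (h1 v)).trans Formula.realize_not.symm,
    fun v => (not_congr (h2 v)).trans Formula.realize_not.symm⟩

theorem CoDef.imp {P P' : (α → G) → Prop} {Q Q' : (α → H) → Prop} (h : CoDef P Q)
    (h' : CoDef P' Q') : CoDef (fun v => P v → P' v) (fun v => Q v → Q' v) := by
  obtain ⟨φ, h1, h2⟩ := h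
  obtain ⟨ψ, h1', h2'⟩ := h'
  exact ⟨φ.imp ψ, fun v => (imp_congr (h1 v) (h1' v)).trans Formula.realize_imp.symm,
    fun v => (imp_congr (h2 v) (h2' v)).trans Formula.realize_imp.symm⟩

theorem CoDef.congr {P P' : (α → G) → Prop} {Q Q' : (α → H) → Prop} (h : CoDef P Q)
    (hP : ∀ v, P' v ↔ P v) (hQ : ∀ v, Q' v ↔ Q v) : CoDef P' Q' := by
  obtain ⟨φ, h1, h2⟩ := h
  exact ⟨φ, fun v => (hP v).trans (h1 v), fun v => (hQ v).trans (h2 v)⟩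

theorem CoDef.and {P P' : (α → G) → Prop} {Q Q' : (α → H) → Prop} (h : CoDef P Q)
    (h' : CoDef P' Q') : CoDef (fun v => P v ∧ P' v) (fun v => Q v ∧ Q' v) :=
  (h.imp h'.not).not.congr (fun v => by tauto) (fun v => by tauto)

theorem CoDef.iff {P P' : (α → G) → Prop} {Q Q' : (α → H) → Prop} (h : CoDef P Q)
    (h' : CoDef P' Q') : CoDef (fun v => P v ↔ P' v) (fun v => Q v ↔ Q' v) :=
  ((h.imp h').and (h'.imp h)).congr (fun v => by tauto) (fun v => by tauto)

/-- The same proposition stands on both sides, so ⊤ or ⊥ serves for both groups. This absorbs side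
conditions on matrix indices. -/
theorem CoDef.const (p : Prop) : CoDef (fun _ : α → G => p) (fun _ : α → H => p) := by
  by_cases hp : p
  · exact ⟨⊤, by simp [hp], by simp [hp]⟩
  · exact ⟨⊥, by simp [hp], by simp [hp]⟩

theorem CoDef.forall_fin [Finite ι] {P : ι → (α → G) → Prop} {Q : ι → (α → H) → Prop}
    (h : ∀ i, CoDef (P i) (Q i)) : CoDef (fun v => ∀ i, P i v) (fun v => ∀ i, Q i v) := by
  choose φ h1 h2 using h
  exact ⟨Formula.iInf φ, fun v => by simp [h1], fun v => by simp [h2]⟩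

theorem CoDef.ex [Finite ι] {P : (α → G) → (ι → G) → Prop} {Q : (α → H) → (ι → H) → Prop}
    (h : CoDef (fun w : α ⊕ ι → G => P (fun a => w (.inl a)) (fun i => w (.inr i)))
      (fun w : α ⊕ ι → H => Q (fun a => w (.inl a)) (fun i => w (.inr i)))) :
    CoDef (fun v => ∃ x, P v x) (fun v => ∃ x, Q v x) := by
  obtain ⟨φ, h1, h2⟩ := h
  refine ⟨φ.iExs ι, fun v => ?_, fun v => ?_⟩
  · rw [Formula.realize_iExs]
    exact exists_congr fun x => h1 (Sum.elim v x)
  · rw [Formula.realize_iExs]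
    exact exists_congr fun x => h2 (Sum.elim v x)

theorem CoDef.ex_one {P : (α → G) → G → Prop} {Q : (α → H) → H → Prop}
    (h : CoDef (fun w : α ⊕ Unit → G => P (fun a => w (.inl a)) (w (.inr ())))
      (fun w : α ⊕ Unit → H => Q (fun a => w (.inl a)) (w (.inr ())))) :
    CoDef (fun v => ∃ x, P v x) (fun v => ∃ x, Q v x) :=
  (CoDef.ex (P := fun v x => P v (x ())) (Q := fun v x => Q v (x ())) h).congr
    (fun _ => ⟨fun ⟨x, hx⟩ => ⟨fun _ => x, hx⟩, fun ⟨x, hx⟩ => ⟨x (), hx⟩⟩)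
    (fun _ => ⟨fun ⟨x, hx⟩ => ⟨fun _ => x, hx⟩, fun ⟨x, hx⟩ => ⟨x (), hx⟩⟩)

theorem CoDef.all_one {P : (α → G) → G → Prop} {Q : (α → H) → H → Prop}
    (h : CoDef (fun w : α ⊕ Unit → G => P (fun a => w (.inl a)) (w (.inr ())))
      (fun w : α ⊕ Unit → H => Q (fun a => w (.inl a)) (w (.inr ())))) :
    CoDef (fun v => ∀ x, P v x) (fun v => ∀ x, Q v x) :=
  (CoDef.ex_one (P := fun v x => ¬ P v x) (Q := fun v x => ¬ Q v x) h.not).not.congr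
    (fun _ => by simp) (fun _ => by simp)

theorem CoDef.reindex {P : (α → G) → Prop} {Q : (α → H) → Prop} (h : CoDef P Q) (f : α → β) :
    CoDef (fun v => P (fun a => v (f a))) (fun v => Q (fun a => v (f a))) := by
  obtain ⟨φ, h1, h2⟩ := h
  refine ⟨φ.relabel f, fun v => ?_, fun v => ?_⟩
  · rw [Formula.realize_relabel]; exact h1 _
  · rw [Formula.realize_relabel]; exact h2 _

theorem CoDef.transfer (hGH : groupLanguage.ElementarilyEquivalent H G)
    {P : (Empty → G) → Prop} {Q : (Empty → H) → Prop} (h : CoDef P Q) (hP : ∀ v, P v) (v) :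
    Q v := by
  obtain ⟨φ, h1, h2⟩ := h
  rw [h2]
  have h3 := (elementarilyEquivalent_iff.1 hGH) φ
  have : v = default := Subsingleton.elim _ _
  subst this
  exact h3.2 ((h1 _).1 (hP _))

theorem CoDef.var_eq (a b : α) :
    CoDef (fun v : α → G => v a = v b) (fun v : α → H => v a = v b) :=
  ⟨(Term.var a).equal (Term.var b), fun v => by simp only [Formula.realize_equal]; rfl,
    fun v => by simp only [Formula.realize_equal]; rfl⟩

theorem CoDef.mul_eq (a b c : α) :
    CoDef (fun v : α → G => v a * v b = v c) (fun v : α → H => v a * v b = v c) :=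
  ⟨(Term.func (L := groupLanguage) GroupFunc.mul ![.var a, .var b]).equal (Term.var c),
    fun v => by simp only [Formula.realize_equal]; rfl,
    fun v => by simp only [Formula.realize_equal]; rfl⟩

theorem CoDef.inv_eq (a b : α) :
    CoDef (fun v : α → G => (v a)⁻¹ = v b) (fun v : α → H => (v a)⁻¹ = v b) :=
  ⟨(Term.func (L := groupLanguage) GroupFunc.inv ![.var a]).equal (Term.var b),
    fun v => by simp only [Formula.realize_equal]; rfl,
    fun v => by simp only [Formula.realize_equal]; rfl⟩

theorem CoDef.one_eq (a : α) :
    CoDef (fun v : α → G => 1 = v a) (fun v : α → H => 1 = v a) :=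
  ⟨(Term.func (L := groupLanguage) GroupFunc.one ![]).equal (Term.var a),
    fun v => by simp only [Formula.realize_equal]; rfl,
    fun v => by simp only [Formula.realize_equal]; rfl⟩

/-- Two group-valued functions of tuples whose graphs are defined by the same formula. -/
def GFun (s : (α → G) → G) (t : (α → H) → H) : Prop :=
  CoDef (fun w : α ⊕ Unit → G => s (fun a => w (.inl a)) = w (.inr ()))
    (fun w : α ⊕ Unit → H => t (fun a => w (.inl a)) = w (.inr ()))

theorem GFun.var (a : α) : GFun (fun v : α → G => v a) (fun v : α → H => v a) :=
  CoDef.var_eq _ _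

theorem GFun.reindex {s : (α → G) → G} {t : (α → H) → H} (h : GFun s t) (f : α → β) :
    GFun (fun v => s (fun a => v (f a))) (fun v => t (fun a => v (f a))) :=
  CoDef.reindex h (Sum.map f id)

theorem GFun.wk {s : (α → G) → G} {t : (α → H) → H} (h : GFun s t) :
    GFun (fun v : α ⊕ β → G => s (fun a => v (.inl a)))
      (fun v : α ⊕ β → H => t (fun a => v (.inl a))) :=
  h.reindex Sum.inl

/-- Functions are known only through their graphs, so substitution quantifies existentially over the
values. -/
theorem CoDef.subst_group [Finite ι] {P : (ι → G) → Prop} {Q : (ι → H) → Prop} (h : CoDef P Q)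
    {s : ι → (α → G) → G} {t : ι → (α → H) → H} (hs : ∀ i, GFun (s i) (t i)) :
    CoDef (fun v => P (fun i => s i v)) (fun v => Q (fun i => t i v)) := by
  refine (CoDef.ex (ι := ι) (P := fun v x => (∀ i, s i v = x i) ∧ P x)
    (Q := fun v x => (∀ i, t i v = x i) ∧ Q x) (.and (.forall_fin fun i => ?_) ?_)).congr ?_ ?_
  · exact CoDef.reindex (hs i) (Sum.elim (fun a => Sum.inl a) fun _ => Sum.inr i)
  · exact h.reindex Sum.inr
  · exact fun v => ⟨fun h => ⟨_, fun _ => rfl, h⟩, fun ⟨x, hx, h⟩ => (funext hx : _ = x) ▸ h⟩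
  · exact fun v => ⟨fun h => ⟨_, fun _ => rfl, h⟩, fun ⟨x, hx, h⟩ => (funext hx : _ = x) ▸ h⟩

theorem CoDef.eq {s s' : (α → G) → G} {t t' : (α → H) → H} (h : GFun s t) (h' : GFun s' t') :
    CoDef (fun v => s v = s' v) (fun v => t v = t' v) :=
  CoDef.subst_group (CoDef.var_eq (0 : Fin 2) 1) (s := ![s, s']) (t := ![t, t'])
    (Fin.forall_fin_two.2 ⟨h, h'⟩)

theorem GFun.mul {s s' : (α → G) → G} {t t' : (α → H) → H} (h : GFun s t) (h' : GFun s' t') :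
    GFun (fun v => s v * s' v) (fun v => t v * t' v) :=
  CoDef.subst_group (α := α ⊕ Unit) (CoDef.mul_eq (0 : Fin 3) 1 2)
    (s := ![fun v => s fun a => v (Sum.inl a), fun v => s' fun a => v (Sum.inl a), fun v => v (Sum.inr ())])
    (t := ![fun v => t fun a => v (Sum.inl a), fun v => t' fun a => v (Sum.inl a), fun v => v (Sum.inr ())])
    (Fin.forall_fin_succ.2 ⟨h.wk, Fin.forall_fin_two.2 ⟨h'.wk, .var (Sum.inr ())⟩⟩)

theorem GFun.inv {s : (α → G) → G} {t : (α → H) → H} (h : GFun s t) :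
    GFun (fun v => (s v)⁻¹) (fun v => (t v)⁻¹) :=
  CoDef.subst_group (α := α ⊕ Unit) (CoDef.inv_eq (0 : Fin 2) 1)
    (s := ![fun v => s fun a => v (Sum.inl a), fun v => v (Sum.inr ())])
    (t := ![fun v => t fun a => v (Sum.inl a), fun v => v (Sum.inr ())])
    (Fin.forall_fin_two.2 ⟨h.wk, .var (Sum.inr ())⟩)

theorem GFun.one : GFun (fun _ : α → G => 1) (fun _ : α → H => 1) :=
  CoDef.one_eq _

end CoDefinability

/-! ### Differences of conjugation actions -/

section Action

variable {G : Type u} {H : Type v} [Group G] [Group H] {α : Type}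

/-- `a` commutes with all commutators. -/
def CommComm (a : G) : Prop := ∀ g h : G, a * (g * h * g⁻¹ * h⁻¹) = g * h * g⁻¹ * h⁻¹ * a

open Classical in
/-- The difference of the conjugation actions of `g` and `h` on the centralizer of all
commutators, extended by `1`. -/
noncomputable def act (g h a : G) : G :=
  if CommComm a then g * a * g⁻¹ * (h * a * h⁻¹)⁻¹ else 1

theorem CoDef.commComm {s : (α → G) → G} {t : (α → H) → H} (h : GFun s t) :
    CoDef (fun v => CommComm (s v)) (fun v => CommComm (t v)) := by
  unfold CommComm
  refine .all_one (.all_one (.eq ?_ ?_))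
  · exact .mul (h.wk.wk) (.mul (.mul (.mul (.var _) (.var _)) (.inv (.var _)))
      (.inv (.var _)))
  · exact .mul (.mul (.mul (.mul (.var _) (.var _)) (.inv (.var _)))
      (.inv (.var _))) (h.wk.wk)

theorem GFun.act {g h a : (α → G) → G} {g' h' a' : (α → H) → H} (hg : GFun g g') (hh : GFun h h')
    (ha : GFun a a') : GFun (fun v => act (g v) (h v) (a v)) (fun v => act (g' v) (h' v) (a' v)) := by
  unfold GFun TriangularGroups.act
  refine CoDef.congr (.and (.imp (.commComm (ha.wk)) (.eq (.mul (.mul (.mul (hg.wk)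
    (ha.wk)) (.inv (hg.wk))) (.inv (.mul (.mul (hh.wk) (ha.wk))
    (.inv (hh.wk))))) (.var (Sum.inr ())))) (.imp (.not (.commComm (ha.wk)))
    (.eq .one (.var (Sum.inr ()))))) ?_ ?_
  · intro v; dsimp only; split_ifs with h <;> simp [h]
  · intro v; dsimp only; split_ifs with h <;> simp [h]

end Action

/-! ### A ring interpreted on pairs of group elements -/

section Coordinates

variable {α β ι κ : Type} {G : Type u} {H : Type v} [Group G] [Group H] {K : Type w} {K' : Type w'}

/-- A set `K` whose elements are coded by pairs of elements of `G`, two pairs coding the same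
element when their actions on the centralizer of the commutators agree. -/
structure Coord (G : Type u) [Group G] (K : Type w) where
  val : G → G → K
  exists_val : ∀ k, ∃ g h, val g h = k
  ac : K → G → G
  ac_val : ∀ g h a, ac (val g h) a = act g h a
  ac_inj : ∀ k k', (∀ a, ac k a = ac k' a) → k = k'

theorem Coord.eq_iff (c : Coord G K) {k k' : K} : k = k' ↔ ∀ a, c.ac k a = c.ac k' a :=
  ⟨fun h _ => h ▸ rfl, c.ac_inj k k'⟩

variable (c : Coord G K) (c' : Coord H K')

/-- Two functions of tuples with values in coordinate sets, whose graphs are defined by the same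
formula. -/
def KFun (s : (α → G) → K) (t : (α → H) → K') : Prop :=
  CoDef (fun w : α ⊕ (Unit ⊕ Unit) → G =>
      s (fun a => w (.inl a)) = c.val (w (.inr (.inl ()))) (w (.inr (.inr ()))))
    (fun w : α ⊕ (Unit ⊕ Unit) → H =>
      t (fun a => w (.inl a)) = c'.val (w (.inr (.inl ()))) (w (.inr (.inr ()))))

variable {c c'}

theorem KFun.wk {s : (α → G) → K} {t : (α → H) → K'} (h : KFun c c' s t) :
    KFun c c' (fun v : α ⊕ β → G => s (fun a => v (.inl a)))
      (fun v : α ⊕ β → H => t (fun a => v (.inl a))) :=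
  CoDef.reindex h (Sum.map Sum.inl id)

theorem KFun.val (g h : α) :
    KFun c c' (fun v : α → G => c.val (v g) (v h)) (fun v : α → H => c'.val (v g) (v h)) := by
  unfold KFun
  simp only [c.eq_iff, c'.eq_iff, Coord.ac_val]
  exact .all_one (.eq (.act (.var _) (.var _) (.var _)) (.act (.var _) (.var _) (.var _)))

/-- Every element of `K` has a code, so a quantifier over `K` is a quantifier over pairs. -/
theorem CoDef.ex_coord [Finite ι] {P : (α → G) → (ι → K) → Prop} {Q : (α → H) → (ι → K') → Prop}
    (h : CoDef (fun w : α ⊕ (ι ⊕ ι) → G => P (fun a => w (.inl a))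
        (fun i => c.val (w (.inr (.inl i))) (w (.inr (.inr i)))))
      (fun w : α ⊕ (ι ⊕ ι) → H => Q (fun a => w (.inl a))
        (fun i => c'.val (w (.inr (.inl i))) (w (.inr (.inr i)))))) :
    CoDef (fun v => ∃ x, P v x) (fun v => ∃ x, Q v x) := by
  refine (CoDef.ex (ι := ι ⊕ ι)
    (P := fun v w => P v fun i => c.val (w (.inl i)) (w (.inr i)))
    (Q := fun v w => Q v fun i => c'.val (w (.inl i)) (w (.inr i))) h).congr (fun v => ?_) fun v => ?_
  · refine ⟨fun ⟨x, hx⟩ => ?_, fun ⟨w, hw⟩ => ⟨_, hw⟩⟩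
    choose g h hgh using fun i => c.exists_val (x i)
    exact ⟨Sum.elim g h, by simpa [hgh] using hx⟩
  · refine ⟨fun ⟨x, hx⟩ => ?_, fun ⟨w, hw⟩ => ⟨_, hw⟩⟩
    choose g h hgh using fun i => c'.exists_val (x i)
    exact ⟨Sum.elim g h, by simpa [hgh] using hx⟩

theorem CoDef.all_coord [Finite ι] {P : (α → G) → (ι → K) → Prop} {Q : (α → H) → (ι → K') → Prop}
    (h : CoDef (fun w : α ⊕ (ι ⊕ ι) → G => P (fun a => w (.inl a))
        (fun i => c.val (w (.inr (.inl i))) (w (.inr (.inr i)))))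
      (fun w : α ⊕ (ι ⊕ ι) → H => Q (fun a => w (.inl a))
        (fun i => c'.val (w (.inr (.inl i))) (w (.inr (.inr i)))))) :
    CoDef (fun v => ∀ x, P v x) (fun v => ∀ x, Q v x) :=
  (CoDef.ex_coord (c := c) (c' := c') (P := fun v x => ¬ P v x) (Q := fun v x => ¬ Q v x)
    h.not).not.congr (fun _ => by simp) (fun _ => by simp)

theorem CoDef.all_coord_one {P : (α → G) → K → Prop} {Q : (α → H) → K' → Prop}
    (h : CoDef (fun w : α ⊕ (Unit ⊕ Unit) → G => P (fun a => w (.inl a))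
        (c.val (w (.inr (.inl ()))) (w (.inr (.inr ())))))
      (fun w : α ⊕ (Unit ⊕ Unit) → H => Q (fun a => w (.inl a))
        (c'.val (w (.inr (.inl ()))) (w (.inr (.inr ())))))) :
    CoDef (fun v => ∀ x, P v x) (fun v => ∀ x, Q v x) :=
  (CoDef.all_coord (c := c) (c' := c') (P := fun v x => P v (x ())) (Q := fun v x => Q v (x ()))
    h).congr (fun _ => ⟨fun h _ => h _, fun h x => h fun _ => x⟩)
    (fun _ => ⟨fun h _ => h _, fun h x => h fun _ => x⟩)

theorem CoDef.ex_coord_one {P : (α → G) → K → Prop} {Q : (α → H) → K' → Prop}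
    (h : CoDef (fun w : α ⊕ (Unit ⊕ Unit) → G => P (fun a => w (.inl a))
        (c.val (w (.inr (.inl ()))) (w (.inr (.inr ())))))
      (fun w : α ⊕ (Unit ⊕ Unit) → H => Q (fun a => w (.inl a))
        (c'.val (w (.inr (.inl ()))) (w (.inr (.inr ())))))) :
    CoDef (fun v => ∃ x, P v x) (fun v => ∃ x, Q v x) :=
  (CoDef.all_coord_one (c := c) (c' := c') (P := fun v x => ¬ P v x) (Q := fun v x => ¬ Q v x)
    h.not).not.congr (fun _ => by simp) (fun _ => by simp)

theorem CoDef.subst_coord [Finite κ] {P : (α → G) → (κ → K) → Prop} {Q : (α → H) → (κ → K') → Prop}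
    (h : CoDef (fun w : α ⊕ (κ ⊕ κ) → G => P (fun a => w (.inl a))
        (fun i => c.val (w (.inr (.inl i))) (w (.inr (.inr i)))))
      (fun w : α ⊕ (κ ⊕ κ) → H => Q (fun a => w (.inl a))
        (fun i => c'.val (w (.inr (.inl i))) (w (.inr (.inr i))))))
    {s : κ → (α → G) → K} {t : κ → (α → H) → K'} (hs : ∀ i, KFun c c' (s i) (t i)) :
    CoDef (fun v => P v (fun i => s i v)) (fun v => Q v (fun i => t i v)) := by
  refine (CoDef.ex_coord (c := c) (c' := c') (P := fun v x => (∀ i, s i v = x i) ∧ P v x)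
    (Q := fun v x => (∀ i, t i v = x i) ∧ Q v x) (.and (.forall_fin fun i => ?_) h)).congr ?_ ?_
  · exact CoDef.reindex (hs i) (Sum.map id (Sum.map (fun _ => i) fun _ => i))
  · exact fun v => ⟨fun h => ⟨_, fun _ => rfl, h⟩, fun ⟨x, hx, h⟩ => (funext hx : _ = x) ▸ h⟩
  · exact fun v => ⟨fun h => ⟨_, fun _ => rfl, h⟩, fun ⟨x, hx, h⟩ => (funext hx : _ = x) ▸ h⟩

theorem GFun.ac {k : (α → G) → K} {k' : (α → H) → K'} {a : (α → G) → G} {a' : (α → H) → H}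
    (hk : KFun c c' k k') (ha : GFun a a') :
    GFun (fun v => c.ac (k v) (a v)) (fun v => c'.ac (k' v) (a' v)) := by
  refine CoDef.subst_coord (c := c) (c' := c') (κ := Unit) (α := α ⊕ Unit)
    (P := fun v k => c.ac (k ()) (a fun i => v (.inl i)) = v (.inr ()))
    (Q := fun v k => c'.ac (k ()) (a' fun i => v (.inl i)) = v (.inr ()))
    ?_ (fun _ => hk.wk)
  simp only [Coord.ac_val]
  exact .eq (.act (.var _) (.var _) ha.wk.wk) (.var _)

theorem CoDef.coord_eq {s s' : (α → G) → K} {t t' : (α → H) → K'} (h : KFun c c' s t)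
    (h' : KFun c c' s' t') : CoDef (fun v => s v = s' v) (fun v => t v = t' v) := by
  simp only [c.eq_iff, c'.eq_iff]
  exact .all_one (.eq (.ac h.wk (.var _)) (.ac h'.wk (.var _)))

/-- The ring operations of `K` are described by the action of `K`. -/
structure Coord.IsRing (c : Coord G K) [Add K] [Mul K] [Neg K] [One K] [Zero K] : Prop where
  add_eq : ∀ {k k' k''}, k + k' = k'' ↔ ∀ a, c.ac k a * c.ac k' a = c.ac k'' a
  mul_eq : ∀ {k k' k''}, k * k' = k'' ↔ ∀ a, c.ac k (c.ac k' a) = c.ac k'' a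
  neg_eq : ∀ {k k'}, -k = k' ↔ ∀ a, c.ac k a * c.ac k' a = 1
  zero_eq : ∀ {k}, 0 = k ↔ ∀ a, c.ac k a = 1
  one_eq : ∀ {k}, 1 = k ↔ ∀ k' a, c.ac k (c.ac k' a) = c.ac k' a

section graphs

variable {x y z : (α → G) → K} {x' y' z' : (α → H) → K'}

theorem CoDef.add_graph (hx : KFun c c' x x') (hy : KFun c c' y y') (hz : KFun c c' z z') :
    CoDef (fun v => ∀ a, c.ac (x v) a * c.ac (y v) a = c.ac (z v) a)
      (fun v => ∀ a, c'.ac (x' v) a * c'.ac (y' v) a = c'.ac (z' v) a) :=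
  .all_one (.eq (.mul (.ac hx.wk (.var _)) (.ac hy.wk (.var _))) (.ac hz.wk (.var _)))

theorem CoDef.mul_graph (hx : KFun c c' x x') (hy : KFun c c' y y') (hz : KFun c c' z z') :
    CoDef (fun v => ∀ a, c.ac (x v) (c.ac (y v) a) = c.ac (z v) a)
      (fun v => ∀ a, c'.ac (x' v) (c'.ac (y' v) a) = c'.ac (z' v) a) :=
  .all_one (.eq (.ac hx.wk (.ac hy.wk (.var _))) (.ac hz.wk (.var _)))

theorem CoDef.neg_graph (hx : KFun c c' x x') (hy : KFun c c' y y') :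
    CoDef (fun v => ∀ a, c.ac (x v) a * c.ac (y v) a = 1)
      (fun v => ∀ a, c'.ac (x' v) a * c'.ac (y' v) a = 1) :=
  .all_one (.eq (.mul (.ac hx.wk (.var _)) (.ac hy.wk (.var _))) .one)

theorem CoDef.zero_graph (hx : KFun c c' x x') :
    CoDef (fun v => ∀ a, c.ac (x v) a = 1) (fun v => ∀ a, c'.ac (x' v) a = 1) :=
  .all_one (.eq (.ac hx.wk (.var _)) .one)

/-- In the intended model the unit acts as a projection to the corner, not as the identity. It is
therefore tested only on elements of the form `c.ac k a`. -/
theorem CoDef.one_graph (hx : KFun c c' x x') :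
    CoDef (fun v => ∀ k a, c.ac (x v) (c.ac k a) = c.ac k a)
      (fun v => ∀ k a, c'.ac (x' v) (c'.ac k a) = c'.ac k a) :=
  .all_coord_one (c := c) (c' := c') (.all_one (.eq (.ac hx.wk.wk
    (.ac (KFun.val (Sum.inr (Sum.inl ())) (Sum.inr (Sum.inr ()))).wk (.var _)))
    (.ac (KFun.val (Sum.inr (Sum.inl ())) (Sum.inr (Sum.inr ()))).wk (.var _))))

end graphs

section ring

variable [Add K] [Mul K] [Neg K] [One K] [Zero K] [Add K'] [Mul K'] [Neg K'] [One K'] [Zero K']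

theorem KFun.add (hc : c.IsRing) (hc' : c'.IsRing) {x y : (α → G) → K} {x' y' : (α → H) → K'}
    (hx : KFun c c' x x') (hy : KFun c c' y y') :
    KFun c c' (fun v => x v + y v) (fun v => x' v + y' v) := by
  unfold KFun
  simp only [hc.add_eq, hc'.add_eq]
  exact .add_graph hx.wk hy.wk (.val _ _)

theorem KFun.mul (hc : c.IsRing) (hc' : c'.IsRing) {x y : (α → G) → K} {x' y' : (α → H) → K'}
    (hx : KFun c c' x x') (hy : KFun c c' y y') :
    KFun c c' (fun v => x v * y v) (fun v => x' v * y' v) := by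
  unfold KFun
  simp only [hc.mul_eq, hc'.mul_eq]
  exact .mul_graph hx.wk hy.wk (.val _ _)

theorem KFun.neg (hc : c.IsRing) (hc' : c'.IsRing) {x : (α → G) → K} {x' : (α → H) → K'}
    (hx : KFun c c' x x') : KFun c c' (fun v => -x v) (fun v => -x' v) := by
  unfold KFun
  simp only [hc.neg_eq, hc'.neg_eq]
  exact .neg_graph hx.wk (.val _ _)

theorem KFun.zero (hc : c.IsRing) (hc' : c'.IsRing) :
    KFun c c' (fun _ : α → G => (0 : K)) (fun _ : α → H => (0 : K')) := by
  unfold KFun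
  simp only [hc.zero_eq, hc'.zero_eq]
  exact .zero_graph (.val _ _)

theorem KFun.one (hc : c.IsRing) (hc' : c'.IsRing) :
    KFun c c' (fun _ : α → G => (1 : K)) (fun _ : α → H => (1 : K')) := by
  unfold KFun
  simp only [hc.one_eq, hc'.one_eq]
  exact .one_graph (.val _ _)

theorem KFun.term [Ring.CompatibleRing K] [Ring.CompatibleRing K'] (hc : c.IsRing)
    (hc' : c'.IsRing) (f : β → α × α) (t : ring.Term β) :
    KFun c c' (fun v : α → G => t.realize (fun b => c.val (v (f b).1) (v (f b).2)))
      (fun v : α → H => t.realize (fun b => c'.val (v (f b).1) (v (f b).2))) := by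
  induction t with
  | var b => exact .val _ _
  | func g ts ih =>
    cases g with
    | add => simpa [Term.realize, Ring.CompatibleRing.funMap_add] using .add hc hc' (ih 0) (ih 1)
    | mul => simpa [Term.realize, Ring.CompatibleRing.funMap_mul] using .mul hc hc' (ih 0) (ih 1)
    | neg => simpa [Term.realize, Ring.CompatibleRing.funMap_neg] using .neg hc hc' (ih 0)
    | zero => simpa [Term.realize, Ring.CompatibleRing.funMap_zero] using .zero hc hc'
    | one => simpa [Term.realize, Ring.CompatibleRing.funMap_one] using .one hc hc'

theorem CoDef.ring_formula [Ring.CompatibleRing K] [Ring.CompatibleRing K'] (hc : c.IsRing)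
    (hc' : c'.IsRing) {n : ℕ} (φ : ring.BoundedFormula Empty n) :
    CoDef (fun w : Empty ⊕ (Fin n ⊕ Fin n) → G =>
        φ.Realize default (fun i => c.val (w (.inr (.inl i))) (w (.inr (.inr i)))))
      (fun w : Empty ⊕ (Fin n ⊕ Fin n) → H =>
        φ.Realize default (fun i => c'.val (w (.inr (.inl i))) (w (.inr (.inr i))))) := by
  induction φ with
  | falsum => exact .const False
  | @equal n t₁ t₂ =>
    have key : ∀ t : ring.Term (Empty ⊕ Fin n), KFun c c'
        (fun w : Empty ⊕ (Fin n ⊕ Fin n) → G => t.realize (Sum.elim (default : Empty → K)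
          fun i => c.val (w (.inr (.inl i))) (w (.inr (.inr i)))))
        (fun w : Empty ⊕ (Fin n ⊕ Fin n) → H => t.realize (Sum.elim (default : Empty → K')
          fun i => c'.val (w (.inr (.inl i))) (w (.inr (.inr i))))) := by
      intro t
      convert KFun.term (c := c) (c' := c') hc hc'
        (Sum.elim Empty.elim fun i => (Sum.inr (Sum.inl i), Sum.inr (Sum.inr i))) t using 3
      all_goals
        ext b
        rcases b with b | b
        · exact b.elim
        · rfl
    exact .coord_eq (key t₁) (key t₂)
  | rel R => cases R
  | imp φ ψ h1 h2 => exact h1.imp h2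
  | @all n φ ih =>
    refine CoDef.all_coord_one (c := c) (c' := c')
      (P := fun (w : Empty ⊕ (Fin n ⊕ Fin n) → G) k => φ.Realize default (Fin.snoc (fun i =>
        c.val (w (.inr (.inl i))) (w (.inr (.inr i)))) k))
      (Q := fun (w : Empty ⊕ (Fin n ⊕ Fin n) → H) k => φ.Realize default (Fin.snoc (fun i =>
        c'.val (w (.inr (.inl i))) (w (.inr (.inr i)))) k)) ?_
    -- The last variable of `φ` is the newly bound one; its code is the pair adjoined by the
    -- quantifier.
    let f : Empty ⊕ (Fin (n + 1) ⊕ Fin (n + 1)) →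
        (Empty ⊕ (Fin n ⊕ Fin n)) ⊕ (Unit ⊕ Unit) := Sum.elim Empty.elim (Sum.elim
      (Fin.snoc (fun i => .inl (.inr (.inl i))) (.inr (.inl ())))
      (Fin.snoc (fun i => .inl (.inr (.inr i))) (.inr (.inr ()))))
    convert ih.reindex f using 3
    all_goals
      ext i
      refine Fin.lastCases ?_ (fun i => ?_) i <;> simp [f]

theorem Coord.elementarilyEquivalent [Ring.CompatibleRing K] [Ring.CompatibleRing K']
    (hc : c.IsRing) (hc' : c'.IsRing) (hGH : groupLanguage.ElementarilyEquivalent H G) :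
    ring.ElementarilyEquivalent K' K := by
  rw [elementarilyEquivalent_iff]
  have key : ∀ φ : ring.Sentence, K ⊨ φ → K' ⊨ φ := by
    intro φ hφ
    have h := (CoDef.ring_formula hc hc' φ).reindex (β := Empty)
      (Sum.elim id (Sum.elim finZeroElim finZeroElim))
    rw [Sentence.Realize, Formula.Realize] at hφ ⊢
    convert h.transfer hGH (fun v => by convert hφ) Empty.elim
  refine fun φ => ⟨fun h => ?_, key φ⟩
  by_contra h'
  exact (Sentence.realize_not K').1 (key φ.not ((Sentence.realize_not K).2 h')) h

end ring

end Coordinates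

/-! ### The field inside a group elementarily equivalent to the given one -/

section FieldTransfer

variable {G : Type u} {H : Type v} [Group G] [Group H] {K : Type w}

/-- The set of all differences of conjugation actions on the centralizer of the commutators. -/
def ActSet (H : Type v) [Group H] : Type v := {f : H → H // ∃ g h, act g h = f}

/-- The tautological coordinates with values in `ActSet H`. -/
noncomputable def actCoord (H : Type v) [Group H] : Coord H (ActSet H) where
  val g h := ⟨act g h, g, h, rfl⟩
  exists_val := fun ⟨_, g, h, hf⟩ => ⟨g, h, Subtype.ext hf⟩
  ac k := k.1
  ac_val _ _ _ := rfl
  ac_inj _ _ h := Subtype.ext (funext h)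

theorem exists_field_actSet (hGH : groupLanguage.ElementarilyEquivalent H G) [Field K]
    (c : Coord G K) (hc : c.IsRing) :
    ∃ _ : Field (ActSet H), (actCoord H).IsRing ∧ FieldElemEquiv (ActSet H) K := by
  -- No operations exist on `ActSet H` yet. The form `∃ s, ∀ s', s = s' ↔ …` states that the graph
  -- has exactly one value, and this is a sentence about the group.
  have hadd : ∀ k k' : ActSet H, ∃ s, ∀ s', s = s' ↔
      ∀ a, (actCoord H).ac k a * (actCoord H).ac k' a = (actCoord H).ac s' a := by
    refine CoDef.transfer hGH (P := fun _ => ∀ k k' : K, ∃ s, ∀ s', s = s' ↔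
      ∀ a, c.ac k a * c.ac k' a = c.ac s' a) (Q := fun _ => ∀ k k' : ActSet H, ∃ s, ∀ s', s = s' ↔
      ∀ a, (actCoord H).ac k a * (actCoord H).ac k' a = (actCoord H).ac s' a)
      ?_ (fun _ k k' => ⟨k + k', fun _ => hc.add_eq⟩) Empty.elim
    refine .all_coord_one (c := c) (c' := actCoord H) (.all_coord_one (c := c) (c' := actCoord H)
      (.ex_coord_one (c := c) (c' := actCoord H) (.all_coord_one (c := c) (c' := actCoord H) ?_)))
    exact .iff (.coord_eq (.val _ _) (.val _ _)) (.add_graph (.val _ _) (.val _ _) (.val _ _))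
  have hmul : ∀ k k' : ActSet H, ∃ s, ∀ s', s = s' ↔
      ∀ a, (actCoord H).ac k ((actCoord H).ac k' a) = (actCoord H).ac s' a := by
    refine CoDef.transfer hGH (P := fun _ => ∀ k k' : K, ∃ s, ∀ s', s = s' ↔
      ∀ a, c.ac k (c.ac k' a) = c.ac s' a) (Q := fun _ => ∀ k k' : ActSet H, ∃ s, ∀ s', s = s' ↔
      ∀ a, (actCoord H).ac k ((actCoord H).ac k' a) = (actCoord H).ac s' a)
      ?_ (fun _ k k' => ⟨k * k', fun _ => hc.mul_eq⟩) Empty.elim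
    refine .all_coord_one (c := c) (c' := actCoord H) (.all_coord_one (c := c) (c' := actCoord H)
      (.ex_coord_one (c := c) (c' := actCoord H) (.all_coord_one (c := c) (c' := actCoord H) ?_)))
    exact .iff (.coord_eq (.val _ _) (.val _ _)) (.mul_graph (.val _ _) (.val _ _) (.val _ _))
  have hneg : ∀ k : ActSet H, ∃ s, ∀ s', s = s' ↔
      ∀ a, (actCoord H).ac k a * (actCoord H).ac s' a = 1 := by
    refine CoDef.transfer hGH (P := fun _ => ∀ k : K, ∃ s, ∀ s', s = s' ↔
      ∀ a, c.ac k a * c.ac s' a = 1) (Q := fun _ => ∀ k : ActSet H, ∃ s, ∀ s', s = s' ↔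
      ∀ a, (actCoord H).ac k a * (actCoord H).ac s' a = 1)
      ?_ (fun _ k => ⟨-k, fun _ => hc.neg_eq⟩) Empty.elim
    refine .all_coord_one (c := c) (c' := actCoord H)
      (.ex_coord_one (c := c) (c' := actCoord H) (.all_coord_one (c := c) (c' := actCoord H) ?_))
    exact .iff (.coord_eq (.val _ _) (.val _ _)) (.neg_graph (.val _ _) (.val _ _))
  have hzero : ∃ s : ActSet H, ∀ s', s = s' ↔ ∀ a, (actCoord H).ac s' a = 1 := by
    refine CoDef.transfer hGH (P := fun _ => ∃ s : K, ∀ s', s = s' ↔ ∀ a, c.ac s' a = 1)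
      (Q := fun _ => ∃ s : ActSet H, ∀ s', s = s' ↔ ∀ a, (actCoord H).ac s' a = 1)
      ?_ (fun _ => ⟨0, fun _ => hc.zero_eq⟩) Empty.elim
    refine .ex_coord_one (c := c) (c' := actCoord H)
      (.all_coord_one (c := c) (c' := actCoord H) ?_)
    exact .iff (.coord_eq (.val _ _) (.val _ _)) (.zero_graph (.val _ _))
  have hone : ∃ s : ActSet H, ∀ s', s = s' ↔
      ∀ k a, (actCoord H).ac s' ((actCoord H).ac k a) = (actCoord H).ac k a := by
    refine CoDef.transfer hGH
      (P := fun _ => ∃ s : K, ∀ s', s = s' ↔ ∀ k a, c.ac s' (c.ac k a) = c.ac k a)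
      (Q := fun _ => ∃ s : ActSet H, ∀ s', s = s' ↔
        ∀ k a, (actCoord H).ac s' ((actCoord H).ac k a) = (actCoord H).ac k a)
      ?_ (fun _ => ⟨1, fun _ => hc.one_eq⟩) Empty.elim
    refine .ex_coord_one (c := c) (c' := actCoord H)
      (.all_coord_one (c := c) (c' := actCoord H) ?_)
    exact .iff (.coord_eq (.val _ _) (.val _ _)) (.one_graph (.val _ _))
  choose add hadd using hadd
  choose mul hmul using hmul
  choose neg hneg using hneg
  obtain ⟨zero, hzero⟩ := hzero
  obtain ⟨one, hone⟩ := hone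
  let := Ring.compatibleRingOfRing K
  have hfield : ∃ f : Field (ActSet H), (∀ x y, x + y = add x y) ∧ (∀ x y, x * y = mul x y) ∧
      (∀ x, -x = neg x) ∧ 0 = zero ∧ 1 = one := by
    let : Add (ActSet H) := ⟨add⟩
    let : Mul (ActSet H) := ⟨mul⟩
    let : Neg (ActSet H) := ⟨neg⟩
    let : Zero (ActSet H) := ⟨zero⟩
    let : One (ActSet H) := ⟨one⟩
    let := Ring.compatibleRingOfRing (ActSet H)
    -- Bare operations suffice to translate ring sentences, so the field axioms come from elementary
    -- equivalence and need no separate check.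
    have hr : (actCoord H).IsRing := ⟨hadd _ _ _, hmul _ _ _, hneg _ _, hzero _, hone _⟩
    have he := Coord.elementarilyEquivalent hc hr hGH
    have : Theory.field.Model (ActSet H) :=
      (ElementarilyEquivalent.theory_model_iff he).2 inferInstance
    exact ⟨Field.fieldOfModelField (ActSet H), fun _ _ => rfl, fun _ _ => rfl, fun _ => rfl, rfl,
      rfl⟩
  obtain ⟨f, h1, h2, h3, h4, h5⟩ := hfield
  have hr : (actCoord H).IsRing := by
    refine ⟨?_, ?_, ?_, ?_, ?_⟩
    · intro k k' k''; rw [h1]; exact hadd _ _ _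
    · intro k k' k''; rw [h2]; exact hmul _ _ _
    · intro k k'; rw [h3]; exact hneg _ _
    · intro k; rw [h4]; exact hzero _
    · intro k; rw [h5]; exact hone _
  let := Ring.compatibleRingOfRing (ActSet H)
  exact ⟨f, hr, Coord.elementarilyEquivalent hc hr hGH⟩

end FieldTransfer

/-! ### The first-order relation between group elements and matrix entries -/

section MatrixRelation

variable {G : Type u} {H : Type v} [Group G] [Group H] {K : Type w} {K' : Type w'}
  {α ι : Type} {m : ℕ}

/-- The indexing type of the parameters that describe the matrix entries. -/
abbrev ParamIndex (m : ℕ) : Type := Fin (m + 1) ⊕ Fin (m + 1) ⊕ (Fin (m + 1) × Fin (m + 1))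

/-- With respect to the parameters `p`, the entries of `g` are proportional to `l`. -/
def EntriesRel (c : Coord G K) (p : ParamIndex m → G) (g : G)
    (l : Fin (m + 1) × Fin (m + 1) → K) : Prop :=
  ∀ i j, i ≠ Fin.last m → c.ac (l (Fin.last m, Fin.last m))
    (p (.inl i) * (g * p (.inr (.inl j)) * g⁻¹) * (p (.inl i))⁻¹ *
      (g * p (.inr (.inl j)) * g⁻¹)⁻¹) = c.ac (l (i, j)) (p (.inr (.inr (i, j))))

variable {c : Coord G K} {c' : Coord H K'}

theorem CoDef.entriesRel {p : ParamIndex m → (α → G) → G} {p' : ParamIndex m → (α → H) → H}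
    (hp : ∀ i, GFun (p i) (p' i)) {g : (α → G) → G} {g' : (α → H) → H} (hg : GFun g g')
    {l : Fin (m + 1) × Fin (m + 1) → (α → G) → K} {l' : Fin (m + 1) × Fin (m + 1) → (α → H) → K'}
    (hl : ∀ ij, KFun c c' (l ij) (l' ij)) :
    CoDef (fun v => EntriesRel c (fun i => p i v) (g v) (fun ij => l ij v))
      (fun v => EntriesRel c' (fun i => p' i v) (g' v) (fun ij => l' ij v)) :=
  .forall_fin fun _ => .forall_fin fun _ => .imp (.const _) (.eq (.ac (hl _)
    (.mul (.mul (.mul (hp _) (.mul (.mul hg (hp _)) (.inv hg))) (.inv (hp _)))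
      (.inv (.mul (.mul hg (hp _)) (.inv hg))))) (.ac (hl _) (hp _)))

variable [Field K] [Field K']

/-- Families of entries of invertible upper triangular matrices. -/
def IsTri (l : Fin (m + 1) × Fin (m + 1) → K) : Prop :=
  (∀ i j, j < i → l (i, j) = 0) ∧ ∀ i, l (i, i) ≠ 0

/-- The matrix product, in terms of families of entries. -/
def mulEntries (l l' : Fin (m + 1) × Fin (m + 1) → K) (ij : Fin (m + 1) × Fin (m + 1)) : K :=
  ∑ k, l (ij.1, k) * l' (k, ij.2)

/-- The relation `EntriesRel` induces an isomorphism modulo centers with the group of triangular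
matrices. -/
def IsMatrixParam (c : Coord G K) (p : ParamIndex m → G) : Prop :=
  (∀ g, ∃ l, IsTri l ∧ EntriesRel c p g l) ∧ (∀ l, IsTri l → ∃ g, EntriesRel c p g l) ∧
  (∀ g g' l l', IsTri l → IsTri l' → EntriesRel c p g l → EntriesRel c p g' l' →
    EntriesRel c p (g * g') (mulEntries l l')) ∧
  ∀ g l, IsTri l → EntriesRel c p g l → ((∀ h, g * h = h * g) ↔
    ∀ l', IsTri l' → ∀ ij, mulEntries l l' ij = mulEntries l' l ij)

theorem KFun.sum (hc : c.IsRing) (hc' : c'.IsRing) {s : ι → (α → G) → K} {t : ι → (α → H) → K'}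
    (h : ∀ i, KFun c c' (s i) (t i)) (A : Finset ι) :
    KFun c c' (fun v => ∑ i ∈ A, s i v) (fun v => ∑ i ∈ A, t i v) := by
  classical
  induction A using Finset.induction_on with
  | empty => simpa using .zero hc hc'
  | insert a A ha ih => simpa [Finset.sum_insert ha] using .add hc hc' (h a) ih

theorem KFun.mulEntries (hc : c.IsRing) (hc' : c'.IsRing)
    {l r : Fin (m + 1) × Fin (m + 1) → (α → G) → K} {l' r' : Fin (m + 1) × Fin (m + 1) → (α → H) → K'}
    (hl : ∀ ij, KFun c c' (l ij) (l' ij)) (hr : ∀ ij, KFun c c' (r ij) (r' ij)) (ij) :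
    KFun c c' (fun v => mulEntries (fun ij => l ij v) (fun ij => r ij v) ij)
      (fun v => mulEntries (fun ij => l' ij v) (fun ij => r' ij v) ij) :=
  .sum hc hc' (fun _ => .mul hc hc' (hl _) (hr _)) _

theorem CoDef.isTri (hc : c.IsRing) (hc' : c'.IsRing)
    {l : Fin (m + 1) × Fin (m + 1) → (α → G) → K} {l' : Fin (m + 1) × Fin (m + 1) → (α → H) → K'}
    (hl : ∀ ij, KFun c c' (l ij) (l' ij)) :
    CoDef (fun v => IsTri (fun ij => l ij v)) (fun v => IsTri (fun ij => l' ij v)) :=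
  .and (.forall_fin fun _ => .forall_fin fun _ => .imp (.const _)
    (.coord_eq (hl _) (.zero hc hc')))
    (.forall_fin fun _ => .not (.coord_eq (hl _) (.zero hc hc')))

theorem CoDef.isMatrixParam (hc : c.IsRing) (hc' : c'.IsRing) :
    CoDef (fun p : ParamIndex m → G => IsMatrixParam c p)
      (fun p : ParamIndex m → H => IsMatrixParam c' p) := by
  refine .and ?_ (.and ?_ (.and ?_ ?_))
  · refine .all_one (.ex_coord (c := c) (c' := c') (.and ?_ ?_))
    · exact .isTri hc hc' fun _ => .val _ _
    · exact .entriesRel (fun _ => .var _) (.var _) fun _ => .val _ _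
  · refine .all_coord (c := c) (c' := c') (.imp ?_ (.ex_one ?_))
    · exact .isTri hc hc' fun _ => .val _ _
    · exact .entriesRel (fun _ => .var _) (.var _) fun _ => .val _ _
  · refine .all_one (.all_one (.all_coord (c := c) (c' := c') (.all_coord (c := c) (c' := c')
      (.imp ?_ (.imp ?_ (.imp ?_ (.imp ?_ ?_)))))))
    · exact .isTri hc hc' fun _ => .val _ _
    · exact .isTri hc hc' fun _ => .val _ _
    · exact .entriesRel (fun _ => .var _) (.var _) fun _ => .val _ _
    · exact .entriesRel (fun _ => .var _) (.var _) fun _ => .val _ _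
    · exact .entriesRel (fun _ => .var _) (.mul (.var _) (.var _))
        (.mulEntries hc hc' (fun _ => .val _ _) fun _ => .val _ _)
  · refine .all_one (.all_coord (c := c) (c' := c') (.imp ?_ (.imp ?_ (.iff (.all_one ?_)
      (.all_coord (c := c) (c' := c') (.imp ?_ (.forall_fin fun ij => ?_)))))))
    · exact .isTri hc hc' fun _ => .val _ _
    · exact .entriesRel (fun _ => .var _) (.var _) fun _ => .val _ _
    · exact .eq (.mul (.var _) (.var _)) (.mul (.var _) (.var _))
    · exact .isTri hc hc' fun _ => .val _ _
    · exact .coord_eq (.mulEntries hc hc' (fun _ => .val _ _) (fun _ => .val _ _) _)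
        (.mulEntries hc hc' (fun _ => .val _ _) (fun _ => .val _ _) _)

theorem IsMatrixParam.transfer (hGH : groupLanguage.ElementarilyEquivalent H G) (hc : c.IsRing)
    (hc' : c'.IsRing) (h : ∃ p : ParamIndex m → G, IsMatrixParam c p) :
    ∃ p : ParamIndex m → H, IsMatrixParam c' p := by
  refine CoDef.transfer hGH (P := fun _ => ∃ p : ParamIndex m → G, IsMatrixParam c p)
    (Q := fun _ => ∃ p : ParamIndex m → H, IsMatrixParam c' p) ?_ (fun _ => h) Empty.elim
  exact .ex ((CoDef.isMatrixParam hc hc').reindex Sum.inr)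

end MatrixRelation

/-! ### From a correspondence to an isomorphism modulo centers -/

section Quotients

/-- A multiplicative correspondence between two groups that matches the centers induces an
isomorphism of the quotients by the centers. -/
theorem nonempty_quotient_center_mulEquiv {A : Type u} {B : Type v} [Group A] [Group B]
    (R : A → B → Prop) (hl : ∀ a, ∃ b, R a b) (hr : ∀ b, ∃ a, R a b)
    (hmul : ∀ a a' b b', R a b → R a' b' → R (a * a') (b * b'))
    (hZ : ∀ a b, R a b → (a ∈ Subgroup.center A ↔ b ∈ Subgroup.center B)) :
    Nonempty ((A ⧸ Subgroup.center A) ≃* (B ⧸ Subgroup.center B)) := by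
  have huniq : ∀ a b b', R a b → R a b' →
      (b : B ⧸ Subgroup.center B) = (b' : B ⧸ Subgroup.center B) := by
    intro a b b' h h'
    -- Any partner `d` of `a⁻¹` replaces an inverse: `d * b` and `d * b'` both correspond to 1,
    -- hence are central, and b⁻¹b' = (db)⁻¹(db').
    obtain ⟨d, hd⟩ := hl a⁻¹
    have h1 := (hZ _ _ (hmul _ _ _ _ hd h)).1 (by simp [one_mem])
    have h2 := (hZ _ _ (hmul _ _ _ _ hd h')).1 (by simp [one_mem])
    rw [QuotientGroup.eq]
    simpa [mul_assoc] using mul_mem (inv_mem h1) h2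
  choose f hf using hl
  let φ : A →* B ⧸ Subgroup.center B := MonoidHom.mk' (fun a => (f a : B ⧸ Subgroup.center B))
    fun a a' => huniq (a * a') _ _ (hf _) (hmul _ _ _ _ (hf a) (hf a'))
  have hφ : Function.Surjective φ := by
    intro b
    induction b using QuotientGroup.induction_on with
    | H b =>
      obtain ⟨a, ha⟩ := hr b
      exact ⟨a, huniq a _ _ (hf a) ha⟩
  have hker : φ.ker = Subgroup.center A := by
    ext a
    rw [MonoidHom.mem_ker, hZ a _ (hf a)]
    exact QuotientGroup.eq_one_iff (f a)
  exact ⟨(QuotientGroup.quotientMulEquivOfEq hker.symm).trans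
    (QuotientGroup.quotientKerEquivOfSurjective φ hφ)⟩

end Quotients

/-! ### Triangular matrices as families of entries -/

section Triangular

variable {K : Type u} [Field K] {m : ℕ}

/-- The entries of a triangular matrix. -/
def entries (g : T (m + 1) K) (ij : Fin (m + 1) × Fin (m + 1)) : K :=
  (g : Matrix.GeneralLinearGroup (Fin (m + 1)) K) ij.1 ij.2

theorem entries_injective : Function.Injective (entries : T (m + 1) K → _) := by
  intro g h hgh
  ext i j
  exact congrFun hgh (i, j)

theorem isTri_entries (g : T (m + 1) K) : IsTri (entries g) := by
  refine ⟨fun i j h => g.2 i j h, fun i => ?_⟩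
  have h1 := Matrix.det_of_isUpperTriangular (M := ((g : Matrix.GeneralLinearGroup (Fin (m + 1)) K) :
    Matrix (Fin (m + 1)) (Fin (m + 1)) K)) (fun i j h => g.2 i j h)
  have h2 := (Matrix.GeneralLinearGroup.det (g : Matrix.GeneralLinearGroup (Fin (m + 1)) K)).ne_zero
  rw [Matrix.GeneralLinearGroup.val_det_apply, h1, Finset.prod_ne_zero_iff] at h2
  exact h2 i (Finset.mem_univ i)

theorem exists_entries_eq {l : Fin (m + 1) × Fin (m + 1) → K} (hl : IsTri l) :
    ∃ g : T (m + 1) K, entries g = l := by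
  have h1 := Matrix.det_of_isUpperTriangular (M := Matrix.of fun i j => l (i, j))
    (fun i j h => hl.1 i j h)
  refine ⟨⟨Matrix.GeneralLinearGroup.mkOfDetNeZero (Matrix.of fun i j => l (i, j)) ?_,
    fun i j h => hl.1 i j h⟩, rfl⟩
  rw [h1, Finset.prod_ne_zero_iff]
  exact fun i _ => hl.2 i

theorem entries_mul (g h : T (m + 1) K) :
    entries (g * h) = mulEntries (entries g) (entries h) := by
  ext ij
  simp [entries, mulEntries, Matrix.mul_apply]

theorem mem_center_iff_entries (g : T (m + 1) K) : g ∈ Subgroup.center (T (m + 1) K) ↔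
    ∀ l', IsTri l' → ∀ ij, mulEntries (entries g) l' ij = mulEntries l' (entries g) ij := by
  rw [Subgroup.mem_center_iff]
  constructor
  · intro h l' hl' ij
    obtain ⟨x, rfl⟩ := exists_entries_eq hl'
    rw [← entries_mul, ← entries_mul, h x]
  · intro h x
    apply entries_injective
    rw [entries_mul, entries_mul]
    exact (funext (h _ (isTri_entries x))).symm

theorem IsMatrixParam.nonempty_mulEquiv {H : Type v} [Group H] {c : Coord H K}
    {p : ParamIndex m → H} (h : IsMatrixParam c p) :
    Nonempty ((H ⧸ Subgroup.center H) ≃* PT (m + 1) K) := by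
  obtain ⟨h1, h2, h3, h4⟩ := h
  refine nonempty_quotient_center_mulEquiv (fun g x => EntriesRel c p g (entries x)) ?_ ?_ ?_ ?_
  · intro g
    obtain ⟨l, hl, hgl⟩ := h1 g
    obtain ⟨x, rfl⟩ := exists_entries_eq hl
    exact ⟨x, hgl⟩
  · exact fun x => h2 _ (isTri_entries x)
  · intro g g' x x' h h'
    rw [entries_mul]
    exact h3 _ _ _ _ (isTri_entries x) (isTri_entries x') h h'
  · intro g x h
    rw [mem_center_iff_entries, ← h4 g _ (isTri_entries x) h, Subgroup.mem_center_iff]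
    exact ⟨fun h y => (h y).symm, fun h y => (h y).symm⟩

end Triangular

/-! ### The interpretation of F in the triangular group -/

section TriangularField

open Matrix

variable {F : Type u} [Field F] {m : ℕ}

/-- The underlying matrix of an element of `T`. -/
def mat : T (m + 1) F →* Matrix (Fin (m + 1)) (Fin (m + 1)) F :=
  (Units.coeHom _).comp (T (m + 1) F).subtype

theorem mat_injective : Function.Injective (mat : T (m + 1) F → _) :=
  fun _ _ h => Subtype.ext (Units.ext h)

theorem mat_eq_zero (g : T (m + 1) F) {i j : Fin (m + 1)} (h : j < i) : mat g i j = 0 :=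
  g.2 i j h

theorem mat_diag_ne_zero (g : T (m + 1) F) (i : Fin (m + 1)) : mat g i i ≠ 0 :=
  (isTri_entries g).2 i

theorem mat_mul_diag (g h : T (m + 1) F) (i : Fin (m + 1)) :
    mat (g * h) i i = mat g i i * mat h i i := by
  rw [map_mul, mul_apply, Finset.sum_eq_single i]
  · intro k _ hk
    rcases lt_or_gt_of_ne hk with h' | h'
    · rw [mat_eq_zero g h', zero_mul]
    · rw [mat_eq_zero h h', mul_zero]
  · simp

theorem mat_mul_inv_mul (g a : T (m + 1) F) {N : Matrix (Fin (m + 1)) (Fin (m + 1)) F}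
    (h : mat g * mat a = N * mat g) : mat (g * a * g⁻¹) = N := by
  have : mat g * mat g⁻¹ = 1 := by rw [← map_mul, mul_inv_cancel, map_one]
  rw [map_mul, map_mul, h, mul_assoc, this, mul_one]

theorem isTri_one_add_single (i j : Fin (m + 1)) (t : F) (hij : i ≤ j) (ht : i = j → 1 + t ≠ 0) :
    IsTri fun ab => (1 + single i j t : Matrix (Fin (m + 1)) (Fin (m + 1)) F) ab.1 ab.2 := by
  constructor
  · intro a b hab
    have : ¬ (i = a ∧ j = b) := fun ⟨h1, h2⟩ => absurd hab (not_lt.2 (h1 ▸ h2 ▸ hij))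
    simp [one_apply_ne hab.ne', this]
  · intro a
    by_cases h : i = a ∧ j = a
    · simpa [h] using ht (h.1.trans h.2.symm)
    · simp [h]

/-- The elementary matrix with entry `t` at `(i, j)`, with `i ≤ j`. -/
noncomputable def root (i j : Fin (m + 1)) (t : F) (hij : i ≤ j)
    (ht : i = j → 1 + t ≠ 0) : T (m + 1) F :=
  (exists_entries_eq (isTri_one_add_single i j t hij ht)).choose

theorem mat_root (i j : Fin (m + 1)) (t : F) (hij : i ≤ j) (ht : i = j → 1 + t ≠ 0) :
    mat (root i j t hij ht) = 1 + single i j t := by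
  ext a b
  exact congrFun (exists_entries_eq (isTri_one_add_single i j t hij ht)).choose_spec (a, b)

theorem mat_mul_single_zero (g : T (m + 1) F) (j : Fin (m + 1)) (t : F) :
    mat g * single 0 j t = single 0 j (mat g 0 0 * t) := by
  ext a b
  by_cases hb : j = b
  · subst hb
    by_cases ha : a = 0
    · subst ha; simp
    · simp [mat_eq_zero g (Fin.pos_of_ne_zero ha), Ne.symm ha]
  · simp [hb, mul_apply]

theorem single_last_mul_mat (g : T (m + 1) F) (i : Fin (m + 1)) (t : F) :
    single i (Fin.last m) t * mat g =
      single i (Fin.last m) (t * mat g (Fin.last m) (Fin.last m)) := by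
  ext a b
  by_cases ha : i = a
  · subst ha
    by_cases hb : b = Fin.last m
    · subst hb; simp
    · simp [mat_eq_zero g (Fin.lt_last_iff_ne_last.2 hb), Ne.symm hb]
  · simp [ha, mul_apply]

/-- The character by which `T` acts on the center of the unitriangular group. -/
noncomputable def chi (g : T (m + 1) F) : F := mat g 0 0 / mat g (Fin.last m) (Fin.last m)

theorem mat_conj (g a : T (m + 1) F) {s t : F}
    (ha : mat a = s • (1 : Matrix _ _ F) + single 0 (Fin.last m) t) :
    mat (g * a * g⁻¹) = s • (1 : Matrix _ _ F) + single 0 (Fin.last m) (chi g * t) := by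
  apply mat_mul_inv_mul
  rw [ha, mul_add, add_mul, Matrix.mul_smul, Matrix.smul_mul, mul_one, one_mul, mat_mul_single_zero,
    single_last_mul_mat, chi, div_mul_eq_mul_div, div_mul_cancel₀ _ (mat_diag_ne_zero g _)]

/-- Commutators have diagonal 1, and multiplying the corner matrix unit by a triangular matrix only
scales it by a diagonal entry. -/
theorem commComm_of_mat (a : T (m + 1) F) {s t : F}
    (ha : mat a = s • (1 : Matrix _ _ F) + single 0 (Fin.last m) t) : CommComm a := by
  intro g h
  have hu : ∀ i, mat (g * h * g⁻¹ * h⁻¹) i i = 1 := by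
    intro i
    have h1 : mat (g * h * g⁻¹ * h⁻¹ * (h * g)) i i = mat (g * h) i i := by
      group
    rw [mat_mul_diag, mat_mul_diag h g, mat_mul_diag g h, mul_comm (mat h i i)] at h1
    exact mul_right_cancel₀ (mul_ne_zero (mat_diag_ne_zero g i) (mat_diag_ne_zero h i))
      (h1.trans (one_mul _).symm)
  apply mat_injective
  rw [map_mul _ a, map_mul _ _ a, ha, mul_add, add_mul, mat_mul_single_zero, single_last_mul_mat,
    hu, hu, one_mul, mul_one, Matrix.mul_smul, Matrix.smul_mul, one_mul, mul_one]

variable [NeZero m]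

theorem zero_ne_last : (0 : Fin (m + 1)) ≠ Fin.last m :=
  fun h => NeZero.ne m (congrArg Fin.val h).symm

/-- The root subgroup of the top right corner. -/
noncomputable def corner (t : F) : T (m + 1) F :=
  root 0 (Fin.last m) t (Fin.zero_le _) fun h => (zero_ne_last h).elim

theorem mat_corner (t : F) : mat (corner t : T (m + 1) F) = 1 + single 0 (Fin.last m) t :=
  mat_root ..

theorem corner_add (s t : F) : (corner (s + t) : T (m + 1) F) = corner s * corner t := by
  apply mat_injective
  rw [map_mul, mat_corner, mat_corner, mat_corner, single_add, mul_add, mul_one, add_mul, one_mul,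
    single_mul_single_of_ne _ _ _ _ zero_ne_last.symm, add_zero, add_assoc]

theorem corner_zero : (corner 0 : T (m + 1) F) = 1 := by
  apply mat_injective
  rw [mat_corner, single_zero, add_zero, map_one]

theorem mat_corner_apply (t : F) : mat (corner t : T (m + 1) F) 0 (Fin.last m) = t := by
  simp [mat_corner, one_apply_ne zero_ne_last]

theorem corner_injective : Function.Injective (corner : F → T (m + 1) F) := by
  intro s t h
  rw [← mat_corner_apply (m := m) s, h, mat_corner_apply]

theorem commComm_corner (t : F) : CommComm (corner t : T (m + 1) F) :=
  commComm_of_mat (s := 1) (t := t) _ (by rw [mat_corner, one_smul])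

theorem exists_ne_zero_ne (F : Type u) [Field F] [Infinite F] (b : F) : ∃ a : F, a ≠ 0 ∧ a ≠ b := by
  classical
  obtain ⟨a, ha⟩ := Infinite.exists_notMem_finset {0, b}
  exact ⟨a, by simpa using ha⟩

/-- Each 1 + e_ij with i < j is itself a commutator, so `a` commutes with every such e_ij; comparing
entries leaves only a scalar and the corner. -/
theorem mat_of_commComm [Infinite F] (a : T (m + 1) F) (h : CommComm a) :
    mat a = mat a 0 0 • (1 : Matrix _ _ F) + single 0 (Fin.last m) (mat a 0 (Fin.last m)) := by
  obtain ⟨u, hu0, hu1⟩ := exists_ne_zero_ne F 1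
  have hcomm : ∀ i j : Fin (m + 1), i < j → mat a * single i j 1 = single i j 1 * mat a := by
    intro i j hij
    have hd : mat (root i i (u - 1) le_rfl (fun _ => by simpa using hu0)) =
      1 + single i i (u - 1) := mat_root ..
    set d := root i i (u - 1) le_rfl (fun _ => by simpa using hu0)
    have hx : ∀ t, mat (root i j t hij.le (fun e => (hij.ne e).elim) : T (m + 1) F) =
      (1 + single i j t : Matrix _ _ F) :=
      fun t => mat_root ..
    set x : F → T (m + 1) F := fun t => root i j t hij.le (fun e => (hij.ne e).elim)
    -- Here `d` is diagonal with `u` in place i, so [d, x(t)] = x((u − 1)t).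
    have hdx : d * x (u - 1)⁻¹ * d⁻¹ * (x (u - 1)⁻¹)⁻¹ = x 1 := by
      rw [mul_inv_eq_iff_eq_mul, mul_inv_eq_iff_eq_mul]
      apply mat_injective
      rw [map_mul, map_mul, map_mul, hd, hx, hx]
      have := sub_ne_zero.2 hu1
      simp [mul_add, add_mul, single_mul_single_of_ne _ _ _ _ hij.ne',
        mul_inv_cancel₀ this]
      abel
    have := congrArg mat (h d (x (u - 1)⁻¹))
    rw [hdx, map_mul, map_mul, hx, mul_add, add_mul, one_mul, mul_one] at this
    exact add_left_cancel this
  have hoff : ∀ p q, p ≠ q → ¬ (p = 0 ∧ q = Fin.last m) → mat a p q = 0 := by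
    intro p q hpq hne
    by_cases hq : q = Fin.last m
    · have hp : p ≠ 0 := fun h => hne ⟨h, hq⟩
      have := congrFun (congrFun (hcomm 0 p (Fin.pos_of_ne_zero hp)) 0) q
      simpa [single_apply, hpq, mul_apply] using this.symm
    · have := congrFun (congrFun (hcomm q (Fin.last m) (Fin.lt_last_iff_ne_last.2 hq)) p)
        (Fin.last m)
      simpa [single_apply, hpq.symm, mul_apply] using this
  have hdiag : ∀ p, mat a p p = mat a 0 0 := by
    intro p
    by_cases hp : p = 0
    · rw [hp]
    · have := congrFun (congrFun (hcomm 0 p (Fin.pos_of_ne_zero hp)) 0) p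
      simpa using this.symm
  ext p q
  by_cases hpq : p = q
  · subst hpq
    have : ¬ (0 = p ∧ Fin.last m = p) := fun h => zero_ne_last (h.1.trans h.2.symm)
    simp [this, hdiag p]
  · by_cases hc : p = 0 ∧ q = Fin.last m
    · simp [hc.1, hc.2, one_apply_ne zero_ne_last]
    · have : ¬ (0 = p ∧ Fin.last m = q) := fun h => hc ⟨h.1.symm, h.2.symm⟩
      simp [hoff p q hpq hc, one_apply_ne hpq, this]

/-- The normalized corner entry. -/
noncomputable def tau (a : T (m + 1) F) : F := mat a 0 (Fin.last m) / mat a 0 0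

/-- Both conjugates have the scalar part of `a`, which cancels in the quotient; dividing by it turns
the corner entry into `tau a`. -/
theorem act_of_commComm [Infinite F] (g h a : T (m + 1) F) (ha : CommComm a) :
    act g h a = corner (tau a * (chi g - chi h)) := by
  have hm := mat_of_commComm a ha
  rw [act, if_pos ha, mul_inv_eq_iff_eq_mul]
  apply mat_injective
  rw [map_mul mat (corner _), mat_conj g a hm, mat_conj h a hm, mat_corner]
  have h0 := mat_diag_ne_zero a 0
  simp only [mul_add, add_mul, one_mul, Matrix.mul_smul, mul_one, smul_single,
    single_mul_single_of_ne _ _ _ _ (zero_ne_last (m := m)).symm, add_zero]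
  rw [add_assoc, ← single_add, tau]
  congr 2
  rw [smul_eq_mul]
  field_simp
  ring

theorem tau_corner (t : F) : tau (corner t : T (m + 1) F) = t := by
  rw [tau, mat_corner_apply]
  simp [mat_corner, zero_ne_last.symm]

theorem exists_chi_eq {b : F} (hb : b ≠ 0) : ∃ g : T (m + 1) F, chi g = b := by
  have hd : mat (root 0 0 (b - 1) le_rfl (fun _ => by simpa using hb) : T (m + 1) F) =
    1 + single 0 0 (b - 1) := mat_root ..
  exact ⟨_, by rw [chi, hd]; simp [NeZero.ne m]⟩

open Classical in
/-- The field `F` as a set of coordinates for the triangular group. -/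
noncomputable def fieldCoord (F : Type u) [Field F] [Infinite F] (m : ℕ) [NeZero m] :
    Coord (T (m + 1) F) F where
  val g h := chi g - chi h
  exists_val k := by
    -- Write k = (k + b) − b with both terms nonzero, since `chi` takes only nonzero values.
    obtain ⟨b, hb0, hb⟩ := exists_ne_zero_ne F (-k)
    obtain ⟨g, hg⟩ := exists_chi_eq (m := m) (b := k + b)
      fun h => hb (eq_neg_of_add_eq_zero_right h)
    obtain ⟨h, hh⟩ := exists_chi_eq (m := m) hb0
    exact ⟨g, h, by rw [hg, hh, add_sub_cancel_right]⟩
  ac k a := if CommComm a then corner (tau a * k) else 1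
  ac_val g h a := by
    split_ifs with ha
    · exact (act_of_commComm g h a ha).symm
    · rw [act, if_neg ha]
  ac_inj k k' h := by
    have := h (corner 1)
    rw [if_pos (commComm_corner 1), if_pos (commComm_corner 1), tau_corner, one_mul, one_mul] at this
    exact corner_injective this

variable [Infinite F]

theorem fieldCoord_ac (k : F) (a : T (m + 1) F) (ha : CommComm a) :
    (fieldCoord F m).ac k a = corner (tau a * k) := if_pos ha

theorem fieldCoord_ac_of_not (k : F) (a : T (m + 1) F) (ha : ¬ CommComm a) :
    (fieldCoord F m).ac k a = 1 := if_neg ha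

theorem fieldCoord_ac_corner (k t : F) :
    (fieldCoord F m).ac k (corner t) = corner (t * k) := by
  rw [fieldCoord_ac _ _ (commComm_corner t), tau_corner]

theorem fieldCoord_ac_add (k k' : F) (a : T (m + 1) F) :
    (fieldCoord F m).ac (k + k') a = (fieldCoord F m).ac k a * (fieldCoord F m).ac k' a := by
  by_cases ha : CommComm a
  · rw [fieldCoord_ac _ _ ha, fieldCoord_ac _ _ ha, fieldCoord_ac _ _ ha, mul_add, corner_add]
  · simp [fieldCoord_ac_of_not _ _ ha]

theorem fieldCoord_ac_mul (k k' : F) (a : T (m + 1) F) :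
    (fieldCoord F m).ac (k * k') a = (fieldCoord F m).ac k ((fieldCoord F m).ac k' a) := by
  by_cases ha : CommComm a
  · rw [fieldCoord_ac _ _ ha, fieldCoord_ac _ _ ha, fieldCoord_ac_corner]
    congr 1; ring
  · rw [fieldCoord_ac_of_not _ _ ha, fieldCoord_ac_of_not _ _ ha, ← corner_zero,
      fieldCoord_ac_corner, zero_mul]

theorem fieldCoord_ac_zero (a : T (m + 1) F) : (fieldCoord F m).ac 0 a = 1 := by
  have := fieldCoord_ac_add 0 0 a
  rw [add_zero] at this
  exact left_eq_mul.1 this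

theorem fieldCoord_isRing : (fieldCoord F m).IsRing where
  add_eq := by
    intro k k' k''
    simp only [(fieldCoord F m).eq_iff, fieldCoord_ac_add]
  mul_eq := by
    intro k k' k''
    simp only [(fieldCoord F m).eq_iff, fieldCoord_ac_mul]
  neg_eq := by
    intro k k'
    rw [neg_eq_iff_add_eq_zero, (fieldCoord F m).eq_iff]
    simp only [fieldCoord_ac_add, fieldCoord_ac_zero]
  zero_eq := by
    intro k
    simp only [(fieldCoord F m).eq_iff, fieldCoord_ac_zero]
    exact forall_congr' fun _ => eq_comm
  one_eq := by
    intro k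
    simp only [← fieldCoord_ac_mul, ← (fieldCoord F m).eq_iff]
    exact ⟨fun h k' => by rw [← h, one_mul], fun h => by simpa using (h 1).symm⟩

end TriangularField

/-! ### Reading matrix entries from commutators -/

section Parameters

open Matrix

variable {F : Type u} [Field F] {m : ℕ}

/-- The factor by which the commutator in `EntriesRel` scales the entry at `(i, j)`. -/
noncomputable def scale (u : F) (i j : Fin (m + 1)) : F :=
  (if i = 0 then u - 1 else 1) * if j = Fin.last m then (u - 1) / u else 1

theorem scale_ne_zero {u : F} (hu0 : u ≠ 0) (hu1 : u ≠ 1) (i j : Fin (m + 1)) :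
    scale u i j ≠ 0 := by
  have := sub_ne_zero.2 hu1
  unfold scale
  split_ifs <;> simp [*]

theorem mulEntries_smul (s t : F) (l l' : Fin (m + 1) × Fin (m + 1) → F) :
    mulEntries (s • l) (t • l') = (s * t) • mulEntries l l' := by
  ext ij
  simp only [mulEntries, Pi.smul_apply, smul_eq_mul, Finset.mul_sum]
  exact Finset.sum_congr rfl fun _ _ => by ring

theorem IsTri.smul {l : Fin (m + 1) × Fin (m + 1) → F} (hl : IsTri l) {s : F} (hs : s ≠ 0) :
    IsTri (s • l) :=
  ⟨fun i j h => by simp [hl.1 i j h], fun i => mul_ne_zero hs (hl.2 i)⟩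

variable [NeZero m]

/-- The parameters from which the entries of a triangular matrix can be read off. -/
noncomputable def param (u : F) (hu : u ≠ 0) : ParamIndex m → T (m + 1) F
  -- On the diagonal the added entry is `u - 1`, so that the resulting diagonal entry `u` is nonzero
  -- and differs from 1 once `u ≠ 1`.
  | .inl i => root 0 i (if i = 0 then u - 1 else 1) (Fin.zero_le _) fun h => by simpa [← h] using hu
  | .inr (.inl j) => root j (Fin.last m) (if j = Fin.last m then u - 1 else 1) (Fin.le_last _)
      fun h => by simpa [h] using hu
  | .inr (.inr (i, j)) => corner (scale u i j)

/-- The commutator identity xw = [x, w]wx with inverses cleared. The term with M at (last, j) occurs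
because the corner factor also meets the last row of `w`; for triangular M it matters only when j is
last. -/
theorem one_add_single_mul_one_add_mul_single (M : Matrix (Fin (m + 1)) (Fin (m + 1)) F)
    {i j : Fin (m + 1)} {c e r : F} (h : c * M i j * e = r + r * M (Fin.last m) j * e) :
    ((1 : Matrix _ _ F) + single (0 : Fin (m + 1)) i c) * (1 + M * single j (Fin.last m) e) =
      (1 + single 0 (Fin.last m) r) * (1 + M * single j (Fin.last m) e) * (1 + single 0 i c) := by
  have h1 : ∀ (k : Fin (m + 1)) (a : F), single (0 : Fin (m + 1)) k a * (M * single j (Fin.last m) e) =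
      single 0 (Fin.last m) (a * M k j * e) := fun k a => by
    rw [← Matrix.mul_assoc, single_mul_mul_single]
  have h2 : M * single j (Fin.last m) e * single 0 i c = 0 := by
    rw [Matrix.mul_assoc, single_mul_single_of_ne _ _ _ _ (zero_ne_last (m := m)).symm, mul_zero]
  simp only [mul_add, add_mul, mul_one, one_mul, h1, h2, h, single_add,
    single_mul_single_of_ne _ _ _ _ (zero_ne_last (m := m)).symm]
  abel

theorem commutator_param (u : F) (hu : u ≠ 0) (g : T (m + 1) F) (i j : Fin (m + 1)) :
    param u hu (.inl i) * (g * param u hu (.inr (.inl j)) * g⁻¹) * (param u hu (.inl i))⁻¹ *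
      (g * param u hu (.inr (.inl j)) * g⁻¹)⁻¹ =
    corner (scale u i j * (mat g i j / mat g (Fin.last m) (Fin.last m))) := by
  have hx : mat (param u hu (.inl i) : T (m + 1) F) =
    1 + single 0 i (if i = 0 then u - 1 else 1) := by
    rw [param]; exact mat_root ..
  have hy : mat (param u hu (.inr (.inl j)) : T (m + 1) F) =
    1 + single j (Fin.last m) (if j = Fin.last m then u - 1 else 1) := by
    rw [param]; exact mat_root ..
  have hg := mat_diag_ne_zero g (Fin.last m)
  have hw : mat (g * param u hu (.inr (.inl j)) * g⁻¹) = 1 + mat g * single j (Fin.last m)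
      ((if j = Fin.last m then u - 1 else 1) / mat g (Fin.last m) (Fin.last m)) := by
    apply mat_mul_inv_mul
    rw [hy, mul_add, mul_one, add_mul, one_mul, mul_assoc, single_last_mul_mat,
      div_mul_cancel₀ _ hg]
  generalize g * param u hu (.inr (.inl j)) * g⁻¹ = w at hw ⊢
  rw [mul_inv_eq_iff_eq_mul, mul_inv_eq_iff_eq_mul]
  apply mat_injective
  rw [map_mul mat, map_mul mat, map_mul mat, hw, hx, mat_corner]
  refine one_add_single_mul_one_add_mul_single (mat g) ?_
  unfold scale
  by_cases hj : j = Fin.last m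
  · subst hj
    simp only [if_true]
    field_simp
    ring
  · rw [mat_eq_zero g (Fin.lt_last_iff_ne_last.2 hj)]
    simp only [if_neg hj]
    ring

variable [Infinite F]

/-- After cancelling `scale`, the relation says l_ij = l_nn · g_ij/g_nn. The last row carries no
condition of its own: triangularity gives its zeros, and l_nn is the free scalar. -/
theorem entriesRel_param_iff {u : F} (hu0 : u ≠ 0) (hu1 : u ≠ 1) (g : T (m + 1) F)
    {l : Fin (m + 1) × Fin (m + 1) → F} (hl : IsTri l) :
    EntriesRel (fieldCoord F m) (param u hu0) g l ↔
      ∃ s : F, s ≠ 0 ∧ l = s • entries g := by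
  have hg := mat_diag_ne_zero g (Fin.last m)
  have h1 : EntriesRel (fieldCoord F m) (param u hu0) g l ↔ ∀ i j, i ≠ Fin.last m →
      l (i, j) = l (Fin.last m, Fin.last m) / mat g (Fin.last m) (Fin.last m) * mat g i j := by
    refine forall_congr' fun i => forall_congr' fun j => forall_congr' fun _ => ?_
    rw [commutator_param u hu0 g i j, fieldCoord_ac_corner, param, fieldCoord_ac_corner,
      corner_injective.eq_iff, mul_assoc, mul_right_inj' (scale_ne_zero hu0 hu1 i j),
      eq_comm, div_mul_comm]
  rw [h1]
  constructor
  · intro h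
    refine ⟨_, div_ne_zero (hl.2 (Fin.last m)) hg, ?_⟩
    ext ⟨i, j⟩
    by_cases hi : i = Fin.last m
    · subst hi
      by_cases hj : j = Fin.last m
      · subst hj
        exact (div_mul_cancel₀ _ hg).symm
      · have hj' := Fin.lt_last_iff_ne_last.2 hj
        rw [hl.1 _ _ hj', Pi.smul_apply, (isTri_entries g).1 _ _ hj', smul_zero]
    · exact h i j hi
  · rintro ⟨s, hs, rfl⟩ i j -
    change s * mat g i j = s * mat g _ _ / _ * _
    rw [mul_div_cancel_right₀ _ hg]

/-- Nonzero scalars multiply along with matrix products and cancel in commutation relations, so the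
ambiguity in `l` is harmless. -/
theorem exists_isMatrixParam : ∃ p : ParamIndex m → T (m + 1) F,
    IsMatrixParam (fieldCoord F m) p := by
  obtain ⟨u, hu0, hu1⟩ := exists_ne_zero_ne F 1
  refine ⟨param u hu0, ?_, ?_, ?_, ?_⟩
  · exact fun g => ⟨entries g, isTri_entries g,
      (entriesRel_param_iff hu0 hu1 g (isTri_entries g)).2 ⟨1, one_ne_zero, (one_smul _ _).symm⟩⟩
  · intro l hl
    obtain ⟨g, rfl⟩ := exists_entries_eq hl
    exact ⟨g, (entriesRel_param_iff hu0 hu1 g hl).2 ⟨1, one_ne_zero, (one_smul _ _).symm⟩⟩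
  · intro g g' l l' hl hl' h h'
    obtain ⟨s, hs, rfl⟩ := (entriesRel_param_iff hu0 hu1 g hl).1 h
    obtain ⟨t, ht, rfl⟩ := (entriesRel_param_iff hu0 hu1 g' hl').1 h'
    rw [mulEntries_smul, ← entries_mul]
    exact (entriesRel_param_iff hu0 hu1 _ ((isTri_entries _).smul (mul_ne_zero hs ht))).2
      ⟨_, mul_ne_zero hs ht, rfl⟩
  · intro g l hl h
    obtain ⟨s, hs, rfl⟩ := (entriesRel_param_iff hu0 hu1 g hl).1 h
    have h1 : (∀ h, g * h = h * g) ↔ g ∈ Subgroup.center (T (m + 1) F) := by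
      rw [Subgroup.mem_center_iff]
      exact forall_congr' fun _ => eq_comm
    rw [h1, mem_center_iff_entries]
    refine forall_congr' fun l' => forall_congr' fun _ => forall_congr' fun ij => ?_
    have h2 := congrFun (mulEntries_smul s 1 (entries g) l') ij
    have h3 := congrFun (mulEntries_smul 1 s l' (entries g)) ij
    rw [one_smul, mul_one] at h2
    rw [one_smul, one_mul] at h3
    rw [h2, h3, Pi.smul_apply, Pi.smul_apply, smul_eq_mul, smul_eq_mul, mul_right_inj' hs]

end Parameters

end TriangularGroups

theorem mainTheorem10 (n : ℕ) (hn : 3 ≤ n) (F : Type u) [Field F] [Infinite F]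
    (hF : ringChar F ≠ 2) (H : Type v) [Group H]
    (hH : TriangularGroups.GroupElemEquiv H (TriangularGroups.T n F)) :
    ∃ (L : Type v) (_ : Field L), TriangularGroups.FieldElemEquiv L F ∧
      Nonempty ((H ⧸ Subgroup.center H) ≃* TriangularGroups.PT n L) := by
  -- With size m + 1 the last index is `Fin.last m`, and m ≠ 0 places the corner off the diagonal.
  obtain ⟨m, rfl⟩ : ∃ m, n = m + 1 := ⟨n - 1, by omega⟩
  have : NeZero m := ⟨by omega⟩
  obtain ⟨f, hr, he⟩ := TriangularGroups.exists_field_actSet hH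
    (TriangularGroups.fieldCoord F m) TriangularGroups.fieldCoord_isRing
  obtain ⟨p, hp⟩ := TriangularGroups.IsMatrixParam.transfer hH
    TriangularGroups.fieldCoord_isRing hr TriangularGroups.exists_isMatrixParam
  exact ⟨TriangularGroups.ActSet H, f, he, hp.nonempty_mulEquiv⟩
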